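/- For abelian groups $G$ and $M$, written additively, let $Z^3_{2\text{-ab}}(G,M)$ be the group (under pointwise addition) of pairs $(h,c)$ of functions $h\colon G^3\to M$, $c\colon G^2\to M$ such that for all $x,y,z,t\in G$ $$h(x,y,z)+h(x,y+z,t)+h(y,z,t)=h(x+y,z,t)+h(x,y,z+t),$$ $$h(y,z,x)+c(x,y+z)+h(x,y,z)=c(x,z)+h(y,x,z)+c(x,y),$$ $$-h(z,x,y)+c(x+y,z)-h(x,y,z)=c(x,z)-h(x,z,y)+c(y,z).$$ Let $B^3_{2\text{-ab}}(G,M)$ be its subgroup of all pairs $(\delta k,\,c_k)$, for arbitrary functions $k\colon G^2\to M$, where $(\delta k)(x,y,z)=k(y,z)-k(x+y,z)+k(x,y+z)-k(x,y)$ and $c_k(x,y)=k(y,x)-k(x,y)$. Put $H^3_{2\text{-ab}}(G,M)=Z^3_{2\text{-ab}}(G,M)/B^3_{2\text{-ab}}(G,M)$, a contravariant functor of $G$ by pullback of cocycles. **Lemma.** Let $M$ be an abelian group. The contravariant functor $G\mapsto H^3_{2\text{-ab}}(G,M)$ from abelian groups to abelian groups turns filtered colimits into limits: for every small filtered category $J$,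 every functor $i\mapsto G_i$ from $J$ to abelian groups and every colimit $\varinjlim G_i$ of it, the homomorphisms $H^3_{2\text{-ab}}(\varinjlim G_i,M)\to H^3_{2\text{-ab}}(G_i,M)$ induced by the structure maps $G_i\to\varinjlim G_i$ exhibit $H^3_{2\text{-ab}}(\varinjlim G_i,M)$ as the limit of the groups $H^3_{2\text{-ab}}(G_i,M)$; that is, the canonical map $$H^3_{2\text{-ab}}\bigl(\varinjlim G_i,M\bigr)\longrightarrow\varprojlim H^3_{2\text{-ab}}(G_i,M)$$ is an isomorphism. -/

import Mathlib

open CategoryTheory CategoryTheory.Limits Opposite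

universe u v

namespace TwoAb

section Groups

variable (G : Type u) [AddCommGroup G] (M : Type v) [AddCommGroup M]

/-- The group `Z³_{2-ab}(G, M)` of 2-abelian 3-cocycles: pairs `(h, c)` of functions
`h : G³ → M` and `c : G² → M` such that `h` is an ordinary 3-cocycle (trivial action) and the two
compatibility (hexagon) conditions hold. -/
def cocycles : AddSubgroup ((G → G → G → M) × (G → G → M)) where
  carrier := {p |
    (∀ x y z t, p.1 x y z + p.1 x (y + z) t + p.1 y z t
      = p.1 (x + y) z t + p.1 x y (z + t)) ∧
    (∀ x y z, p.1 y z x + p.2 x (y + z) + p.1 x y z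
      = p.2 x z + p.1 y x z + p.2 x y) ∧
    (∀ x y z, -p.1 z x y + p.2 (x + y) z - p.1 x y z
      = p.2 x z - p.1 x z y + p.2 y z)}
  zero_mem' := by simp
  add_mem' := by
    rintro p q ⟨hp, hp₁, hp₂⟩ ⟨hq, hq₁, hq₂⟩
    refine ⟨fun x y z t => ?_, fun x y z => ?_, fun x y z => ?_⟩
    · have := congrArg₂ (· + ·) (hp x y z t) (hq x y z t)
      simp only [Prod.fst_add, Pi.add_apply] at this ⊢
      convert this using 1 <;> abel
    · have := congrArg₂ (· + ·) (hp₁ x y z) (hq₁ x y z)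
      simp only [Prod.fst_add, Prod.snd_add, Pi.add_apply] at this ⊢
      convert this using 1 <;> abel
    · have := congrArg₂ (· + ·) (hp₂ x y z) (hq₂ x y z)
      simp only [Prod.fst_add, Prod.snd_add, Pi.add_apply] at this ⊢
      convert this using 1 <;> abel
  neg_mem' := by
    rintro p ⟨hp, hp₁, hp₂⟩
    refine ⟨fun x y z t => ?_, fun x y z => ?_, fun x y z => ?_⟩
    · have := congrArg (- ·) (hp x y z t)
      simp only [Prod.fst_neg, Pi.neg_apply] at this ⊢
      convert this using 1 <;> abel
    · have := congrArg (- ·) (hp₁ x y z)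
      simp only [Prod.fst_neg, Prod.snd_neg, Pi.neg_apply] at this ⊢
      convert this using 1 <;> abel
    · have := congrArg (- ·) (hp₂ x y z)
      simp only [Prod.fst_neg, Prod.snd_neg, Pi.neg_apply] at this ⊢
      convert this using 1 <;> abel

/-- The 2-abelian coboundary of `k : G² → M`: the pair `(δ k, c)` with
`δ k (x, y, z) = k(y, z) - k(x + y, z) + k(x, y + z) - k(x, y)` and `c(x, y) = k(y, x) - k(x, y)`.
With these signs the pair is a 2-abelian 3-cocycle. -/
def coboundary : (G → G → M) →+ cocycles G M where
  toFun k :=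
    ⟨(fun x y z => k y z - k (x + y) z + k x (y + z) - k x y, fun x y => k y x - k x y), by
      refine ⟨fun x y z t => ?_, fun x y z => ?_, fun x y z => ?_⟩
      · simp only [add_assoc]
        abel
      · simp only [add_comm z x, add_comm y x]
        abel
      · simp only [add_comm z x, add_comm z y]
        abel⟩
  map_zero' := by
    ext <;> simp
  map_add' k l := by
    ext <;> simp <;> abel

/-- The third 2-abelian cohomology group `H³_{2-ab}(G, M) = Z³_{2-ab}(G, M) / B³_{2-ab}(G, M)`. -/
abbrev H3 : Type (max u v) := cocycles G M ⧸ (coboundary G M).range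

end Groups

section Functoriality

variable {G G' : Type u} [AddCommGroup G] [AddCommGroup G'] (M : Type v) [AddCommGroup M]

/-- Pullback of 2-abelian 3-cocycles along a homomorphism `f : G → G'`. -/
def cocyclesMap (f : G →+ G') : cocycles G' M →+ cocycles G M where
  toFun p :=
    ⟨(fun x y z => p.1.1 (f x) (f y) (f z), fun x y => p.1.2 (f x) (f y)), by
      obtain ⟨p, hp, hp₁, hp₂⟩ := p
      refine ⟨fun x y z t => ?_, fun x y z => ?_, fun x y z => ?_⟩
      · simpa only [map_add] using hp (f x) (f y) (f z) (f t)
      · simpa only [map_add] using hp₁ (f x) (f y) (f z)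
      · simpa only [map_add] using hp₂ (f x) (f y) (f z)⟩
  map_zero' := rfl
  map_add' _ _ := rfl

/-- The homomorphism `H³_{2-ab}(G', M) → H³_{2-ab}(G, M)` induced by `f : G → G'`. -/
def H3Map (f : G →+ G') : H3 G' M →+ H3 G M :=
  QuotientAddGroup.map _ _ (cocyclesMap M f) (by
    rintro _ ⟨k, rfl⟩
    refine ⟨fun x y => k (f x) (f y), ?_⟩
    ext <;> simp [coboundary, cocyclesMap])

end Functoriality

/-- The contravariant functor `G ↦ H³_{2-ab}(G, M)` from abelian groups to abelian groups. -/
def H3Functor (M : Type v) [AddCommGroup M] :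
    AddCommGrpCat.{u}ᵒᵖ ⥤ AddCommGrpCat.{max u v} where
  obj G := AddCommGrpCat.of (H3 G.unop M)
  map f := AddCommGrpCat.ofHom (H3Map M f.unop.hom)
  map_id G := by
    ext x
    rfl
  map_comp f g := by
    ext x
    rfl

end TwoAb

set_option linter.unusedSectionVars false

/-! Cochains `(h, c)` are functionals on the free group C₄ on G³ ⊔ G², and `chainD` sends C₄ to C₃ =
ℤ[G²]. Let Z be its kernel and B ⊆ Z the span of the pentagon and hexagon chains. Cocycles are the
functionals killing B; coboundaries are those factoring through `chainD`. If D is divisible, hence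
injective, a functional factors through `chainD` iff it kills Z, so H³(G, D) = Hom(Z/B, D). Finite
products, free groups and kernels commute with filtered colimits, so cycles of the colimit and
equalities between them appear at some stage, and Hom(-, D) turns this into a limit
(`exists_cycle_lift`, `exists_cocycle_of_forall_divisible`). For general M, embed M in a divisible
D. Symmetric 2-cocycles with values in the divisible group D/M are trivial
(`exists_of_cobd_eq_zero`), so H³(G, M) → H³(G, D) is injective, with image the kernel of the map to
H³(G, D/M). A kernel of maps between such limits is again such a limit (`exists_eq_cobd_of_forall`,
`exists_cocycle_of_forall`). -/

namespace TwoAb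

/-! ### Chains dual to the cochains, and their cycles -/

section Chains

variable {G : Type u} [AddCommGroup G] {G' : Type u} [AddCommGroup G']
  {M : Type v} [AddCommGroup M]

/-- The indexing set of the free generators of the group of 4-chains. -/
abbrev Cell (G : Type u) : Type u := (G × G × G) ⊕ (G × G)

/-- The map on generators of 4-chains induced by a map of sets. -/
def Cell.map {G G' : Type u} (f : G → G') : Cell G → Cell G' :=
  Sum.map (Prod.map f (Prod.map f f)) (Prod.map f f)

/-- The generator of the 4-chains dual to `h`. -/
noncomputable def assocCell (x y z : G) : Cell G →₀ ℤ := Finsupp.single (Sum.inl (x, y, z)) 1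

/-- The generator of the 4-chains dual to `c`. -/
noncomputable def braidCell (x y : G) : Cell G →₀ ℤ := Finsupp.single (Sum.inr (x, y)) 1

/-- The generator of the 3-chains. -/
noncomputable def pairCell (x y : G) : G × G →₀ ℤ := Finsupp.single (x, y) 1

/-- The differential from 4-chains to 3-chains. -/
noncomputable def chainD (G : Type u) [AddCommGroup G] : (Cell G →₀ ℤ) →ₗ[ℤ] (G × G →₀ ℤ) :=
  Finsupp.linearCombination ℤ (Sum.elim
    (fun t => pairCell t.2.1 t.2.2 - pairCell (t.1 + t.2.1) t.2.2
      + pairCell t.1 (t.2.1 + t.2.2) - pairCell t.1 t.2.1)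
    (fun t => pairCell t.2 t.1 - pairCell t.1 t.2))

/-- Evaluation of a cochain on 4-chains. -/
noncomputable def eval (p : (G → G → G → M) × (G → G → M)) : (Cell G →₀ ℤ) →ₗ[ℤ] M :=
  Finsupp.linearCombination ℤ (Sum.elim (fun t => p.1 t.1 t.2.1 t.2.2) (fun t => p.2 t.1 t.2))

/-- The map on 4-chains induced by a homomorphism. -/
noncomputable def chainMap (f : G →+ G') : (Cell G →₀ ℤ) →ₗ[ℤ] (Cell G' →₀ ℤ) :=
  Finsupp.lmapDomain ℤ ℤ (Cell.map f)

/-- The map on 3-chains induced by a homomorphism. -/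
noncomputable def pairMap (f : G →+ G') : (G × G →₀ ℤ) →ₗ[ℤ] (G' × G' →₀ ℤ) :=
  Finsupp.lmapDomain ℤ ℤ (Prod.map f f)

/-- Pullback of cochains. -/
def pullback (f : G →+ G') (p : (G' → G' → G' → M) × (G' → G' → M)) :
    (G → G → G → M) × (G → G → M) :=
  (fun x y z => p.1 (f x) (f y) (f z), fun x y => p.2 (f x) (f y))

/-- The coboundary as a cochain. -/
def cobd (k : G → G → M) : (G → G → G → M) × (G → G → M) :=
  (fun x y z => k y z - k (x + y) z + k x (y + z) - k x y, fun x y => k y x - k x y)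

@[simp] theorem eval_assocCell (p : (G → G → G → M) × (G → G → M)) (x y z : G) :
    eval p (assocCell x y z) = p.1 x y z := by
  simp [eval, assocCell]

@[simp] theorem eval_braidCell (p : (G → G → G → M) × (G → G → M)) (x y : G) :
    eval p (braidCell x y) = p.2 x y := by
  simp [eval, braidCell]

@[simp] theorem chainMap_assocCell (f : G →+ G') (x y z : G) :
    chainMap f (assocCell x y z) = assocCell (f x) (f y) (f z) := by
  simp [chainMap, assocCell, Cell.map]

@[simp] theorem chainMap_braidCell (f : G →+ G') (x y : G) :
    chainMap f (braidCell x y) = braidCell (f x) (f y) := by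
  simp [chainMap, braidCell, Cell.map]

@[simp] theorem pairMap_pairCell (f : G →+ G') (x y : G) :
    pairMap f (pairCell x y) = pairCell (f x) (f y) := by
  simp [pairMap, pairCell]

@[simp] theorem chainD_assocCell (x y z : G) :
    chainD G (assocCell x y z) = pairCell y z - pairCell (x + y) z
      + pairCell x (y + z) - pairCell x y := by
  simp [chainD, assocCell]

@[simp] theorem chainD_braidCell (x y : G) :
    chainD G (braidCell x y) = pairCell y x - pairCell x y := by
  simp [chainD, braidCell]

theorem chain_hom_ext {N : Type*} [AddCommGroup N] {φ ψ : (Cell G →₀ ℤ) →ₗ[ℤ] N}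
    (h₁ : ∀ x y z, φ (assocCell x y z) = ψ (assocCell x y z))
    (h₂ : ∀ x y, φ (braidCell x y) = ψ (braidCell x y)) : φ = ψ := by
  refine Finsupp.lhom_ext' fun t => LinearMap.ext_ring ?_
  rcases t with ⟨x, y, z⟩ | ⟨x, y⟩
  · exact h₁ x y z
  · exact h₂ x y

theorem exists_eval_eq (φ : (Cell G →₀ ℤ) →ₗ[ℤ] M) :
    ∃ p : (G → G → G → M) × (G → G → M), eval p = φ :=
  ⟨(fun x y z => φ (assocCell x y z), fun x y => φ (braidCell x y)),
    chain_hom_ext (by simp) (by simp)⟩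

theorem eval_sub (p q : (G → G → G → M) × (G → G → M)) : eval (p - q) = eval p - eval q :=
  chain_hom_ext (by simp) (by simp)

theorem eval_chainMap (f : G →+ G') (p : (G' → G' → G' → M) × (G' → G' → M))
    (z : Cell G →₀ ℤ) : eval p (chainMap f z) = eval (pullback f p) z := by
  have : eval p ∘ₗ chainMap f = eval (pullback f p) :=
    chain_hom_ext (by simp [pullback]) (by simp [pullback])
  exact LinearMap.congr_fun this z

theorem chainD_chainMap (f : G →+ G') (z : Cell G →₀ ℤ) :
    chainD G' (chainMap f z) = pairMap f (chainD G z) := by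
  have : chainD G' ∘ₗ chainMap f = pairMap f ∘ₗ chainD G :=
    chain_hom_ext (by simp) (by simp)
  exact LinearMap.congr_fun this z

/-- `cobd k` is the linear extension of `k` composed with `chainD`. -/
theorem eval_cobd_of_chainD_eq_zero (k : G → G → M) {z : Cell G →₀ ℤ} (hz : chainD G z = 0) :
    eval (cobd k) z = 0 := by
  have : eval (cobd k) =
      Finsupp.linearCombination ℤ (fun t : G × G => k t.1 t.2) ∘ₗ chainD G :=
    chain_hom_ext (by simp [cobd, pairCell]) (by simp [cobd, pairCell])
  rw [this, LinearMap.comp_apply, hz, map_zero]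

/-- The boundary dual to the associativity condition. -/
noncomputable def pentagonChain (x y z t : G) : Cell G →₀ ℤ :=
  assocCell x y z + assocCell x (y + z) t + assocCell y z t
    - (assocCell (x + y) z t + assocCell x y (z + t))

/-- The boundary dual to the first hexagon condition. -/
noncomputable def hexagonChain (x y z : G) : Cell G →₀ ℤ :=
  assocCell y z x + braidCell x (y + z) + assocCell x y z
    - (braidCell x z + assocCell y x z + braidCell x y)

/-- The boundary dual to the second hexagon condition. -/
noncomputable def hexagonChain' (x y z : G) : Cell G →₀ ℤ :=
  -assocCell z x y + braidCell (x + y) z - assocCell x y z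
    - (braidCell x z - assocCell x z y + braidCell y z)

theorem mem_cocycles_iff (p : (G → G → G → M) × (G → G → M)) :
    p ∈ cocycles G M ↔ (∀ x y z t, eval p (pentagonChain x y z t) = 0) ∧
      (∀ x y z, eval p (hexagonChain x y z) = 0) ∧
      (∀ x y z, eval p (hexagonChain' x y z) = 0) := by
  simp only [pentagonChain, hexagonChain, hexagonChain', map_sub, map_add, map_neg,
    eval_assocCell, eval_braidCell, sub_eq_zero]
  rfl

/-- With the two hexagon analogues, this makes the cocycle conditions depend only on values on
cycles. -/
theorem chainD_pentagonChain (x y z t : G) : chainD G (pentagonChain x y z t) = 0 := by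
  simp only [pentagonChain, map_sub, map_add, chainD_assocCell, add_assoc]
  abel

theorem chainD_hexagonChain (x y z : G) : chainD G (hexagonChain x y z) = 0 := by
  simp only [hexagonChain, map_sub, map_add, chainD_assocCell, chainD_braidCell,
    add_comm z x, add_comm y x]
  abel

theorem chainD_hexagonChain' (x y z : G) : chainD G (hexagonChain' x y z) = 0 := by
  simp only [hexagonChain', map_sub, map_add, map_neg, chainD_assocCell, chainD_braidCell,
    add_comm z x, add_comm z y]
  abel

theorem chainMap_pentagonChain (f : G →+ G') (x y z t : G) :
    chainMap f (pentagonChain x y z t) = pentagonChain (f x) (f y) (f z) (f t) := by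
  simp [pentagonChain]

theorem chainMap_hexagonChain (f : G →+ G') (x y z : G) :
    chainMap f (hexagonChain x y z) = hexagonChain (f x) (f y) (f z) := by
  simp [hexagonChain]

theorem chainMap_hexagonChain' (f : G →+ G') (x y z : G) :
    chainMap f (hexagonChain' x y z) = hexagonChain' (f x) (f y) (f z) := by
  simp [hexagonChain']

end Chains

/-! ### Divisible coefficients and change of coefficients -/

section Divisible

variable {G : Type u} [AddCommGroup G] {D : Type v} [AddCommGroup D]

/-- Over a divisible group, a cochain vanishing on cycles is a coboundary. -/
theorem exists_eq_cobd_of_eval_eq_zero [DivisibleBy D ℤ] (p : (G → G → G → D) × (G → G → D))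
    (hp : ∀ z, chainD G z = 0 → eval p z = 0) : ∃ k, p = cobd k := by
  have hle : LinearMap.ker (chainD G) ≤ LinearMap.ker (eval p) := hp
  -- `eval p` descends to the image of `chainD`; injectivity of D extends it to all 3-chains, and
  -- `k` is read off on the generators.
  obtain ⟨φ, hφ⟩ := (Module.Baer.of_divisible D).extension_property
    (LinearMap.range (chainD G)).subtype Subtype.val_injective
    ((LinearMap.ker (chainD G)).liftQ (eval p) hle ∘ₗ
      (chainD G).quotKerEquivRange.symm.toLinearMap)
  have key (z) : φ (chainD G z) = eval p z := by
    have := LinearMap.congr_fun hφ ⟨chainD G z, z, rfl⟩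
    have hz : (chainD G).quotKerEquivRange.symm ⟨chainD G z, z, rfl⟩ =
        Submodule.Quotient.mk z := by
      rw [LinearEquiv.symm_apply_eq]
      rfl
    simpa [hz] using this
  refine ⟨fun x y => φ (pairCell x y), ?_⟩
  ext x y z
  · simpa [cobd] using (key (assocCell x y z)).symm
  · simpa [cobd] using (key (braidCell x y)).symm

/-- The type underlying the extension defined by a symmetric 2-cocycle. -/
@[ext] structure CocycleExt (G : Type u) (D : Type v) where
  /-- The component in the kernel. -/
  fst : D
  /-- The component in the quotient. -/
  snd : G

/-- The extension of `G` by `D` defined by a normalised symmetric 2-cocycle. -/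
@[reducible] def CocycleExt.addCommGroup (k : G → G → D) (h₀ : ∀ x, k 0 x = 0)
    (hk : ∀ x y z, k y z - k (x + y) z + k x (y + z) - k x y = 0)
    (hs : ∀ x y, k y x = k x y) : AddCommGroup (CocycleExt G D) where
  add a b := ⟨a.fst + b.fst + k a.snd b.snd, a.snd + b.snd⟩
  zero := ⟨0, 0⟩
  neg a := ⟨-a.fst - k (-a.snd) a.snd, -a.snd⟩
  nsmul := @nsmulRec _ ⟨⟨0, 0⟩⟩ ⟨fun a b => ⟨a.fst + b.fst + k a.snd b.snd, a.snd + b.snd⟩⟩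
  zsmul := @zsmulRec _ ⟨⟨0, 0⟩⟩ ⟨fun a b => ⟨a.fst + b.fst + k a.snd b.snd, a.snd + b.snd⟩⟩
    ⟨fun a => ⟨-a.fst - k (-a.snd) a.snd, -a.snd⟩⟩
    (@nsmulRec _ ⟨⟨0, 0⟩⟩ ⟨fun a b => ⟨a.fst + b.fst + k a.snd b.snd, a.snd + b.snd⟩⟩)
  add_assoc a b c := by
    refine CocycleExt.ext ?_ (add_assoc a.snd b.snd c.snd)
    change a.fst + b.fst + k a.snd b.snd + c.fst + k (a.snd + b.snd) c.snd =
      a.fst + (b.fst + c.fst + k b.snd c.snd) + k a.snd (b.snd + c.snd)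
    rw [← sub_eq_zero, ← neg_eq_zero, ← hk a.snd b.snd c.snd]
    abel
  zero_add a := by
    refine CocycleExt.ext ?_ (zero_add a.snd)
    change 0 + a.fst + k 0 a.snd = a.fst
    rw [h₀, zero_add, add_zero]
  add_zero a := by
    refine CocycleExt.ext ?_ (add_zero a.snd)
    change a.fst + 0 + k a.snd 0 = a.fst
    rw [hs, h₀, add_zero, add_zero]
  neg_add_cancel a := by
    refine CocycleExt.ext ?_ (neg_add_cancel a.snd)
    change -a.fst - k (-a.snd) a.snd + a.fst + k (-a.snd) a.snd = 0
    abel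
  add_comm a b := by
    refine CocycleExt.ext ?_ (add_comm a.snd b.snd)
    change a.fst + b.fst + k a.snd b.snd = b.fst + a.fst + k b.snd a.snd
    rw [hs, add_comm a.fst]

/-- A symmetric 2-cocycle with values in a divisible group is a coboundary. -/
theorem exists_of_cobd_eq_zero [DivisibleBy D ℤ] (k : G → G → D) (hk : cobd k = 0) :
    ∃ f : G → D, ∀ x y, k x y = f x + f y - f (x + y) := by
  have hk₁ (x y z) : k y z - k (x + y) z + k x (y + z) - k x y = 0 :=
    congrFun (congrFun (congrFun (congrArg Prod.fst hk) x) y) z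
  have hs (x y) : k y x = k x y :=
    sub_eq_zero.1 (congrFun (congrFun (congrArg Prod.snd hk) x) y)
  have h₀ (x) : k 0 x = k 0 0 := by
    have := hk₁ 0 0 x
    simp only [zero_add, sub_self] at this
    exact sub_eq_zero.1 this
  -- By `h₀`, subtracting the constant `k 0 0` normalises the cocycle.
  let l : G → G → D := fun x y => k x y - k 0 0
  let _ : AddCommGroup (CocycleExt G D) := CocycleExt.addCommGroup l
    (fun x => by simp [l, h₀ x])
    (fun x y z => by rw [← hk₁ x y z]; simp only [l]; abel)
    (fun x y => by simp only [l, hs x y])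
  have add_def (a b : CocycleExt G D) :
      a + b = ⟨a.fst + b.fst + l a.snd b.snd, a.snd + b.snd⟩ := rfl
  let i : D →+ CocycleExt G D := AddMonoidHom.mk' (fun d => ⟨d, 0⟩) fun a b => by
    rw [add_def]; ext <;> simp [l]
  -- The extension splits because D is injective; `r` is a retraction onto D.
  obtain ⟨r, hr⟩ := (Module.Baer.of_divisible D).extension_property_addMonoidHom i
    (fun a b h => congrArg CocycleExt.fst h) (AddMonoidHom.id D)
  have hri (d : D) : r ⟨d, 0⟩ = d := DFunLike.congr_fun hr d
  have hr' (d : D) (x : G) : r ⟨d, x⟩ = d + r ⟨0, x⟩ := by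
    have : (⟨d, x⟩ : CocycleExt G D) = ⟨d, 0⟩ + ⟨0, x⟩ := by
      rw [add_def]; ext <;> simp [l, h₀ x]
    rw [this, map_add, hri]
  -- The splitting trivialises `l`; the added constant accounts for `k 0 0`, since e + e - e = e.
  refine ⟨fun x => r ⟨0, x⟩ + k 0 0, fun x y => ?_⟩
  have h := map_add r ⟨0, x⟩ ⟨0, y⟩
  rw [add_def, hr'] at h
  simp only [l, zero_add] at h
  rw [← eq_sub_iff_add_eq, sub_eq_iff_eq_add] at h
  beta_reduce
  rw [h]
  generalize r ⟨0, x⟩ = a, r ⟨0, y⟩ = b, r ⟨0, x + y⟩ = d, k 0 0 = e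
  abel

theorem cobd_sub {M : Type v} [AddCommGroup M] (k l : G → G → M) :
    cobd (k - l) = cobd k - cobd l :=
  congrArg Subtype.val (map_sub (coboundary G M) k l)

/-- The cochain obtained by applying a homomorphism to the values. -/
def push {M : Type v} [AddCommGroup M] (φ : M →+ D) (p : (G → G → G → M) × (G → G → M)) :
    (G → G → G → D) × (G → G → D) :=
  (fun x y z => φ (p.1 x y z), fun x y => φ (p.2 x y))

theorem push_cobd {M : Type v} [AddCommGroup M] (φ : M →+ D) (k : G → G → M) :
    push φ (cobd k) = cobd (fun x y => φ (k x y)) := by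
  ext <;> simp [push, cobd]

theorem push_sub {M : Type v} [AddCommGroup M] (φ : M →+ D)
    (p q : (G → G → G → M) × (G → G → M)) : push φ (p - q) = push φ p - push φ q := by
  ext <;> simp [push]

theorem push_injective {M : Type v} [AddCommGroup M] {φ : M →+ D} (hφ : Function.Injective φ) :
    Function.Injective (push (G := G) φ) := by
  intro p q h
  ext x y z
  · exact hφ (congrFun (congrFun (congrFun (congrArg Prod.fst h) x) y) z)
  · exact hφ (congrFun (congrFun (congrArg Prod.snd h) x) y)

theorem push_mem_cocycles {M : Type v} [AddCommGroup M] (φ : M →+ D)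
    {p : (G → G → G → M) × (G → G → M)} (hp : p ∈ cocycles G M) : push φ p ∈ cocycles G D := by
  refine ⟨fun x y z t => ?_, fun x y z => ?_, fun x y z => ?_⟩
  · simpa [push] using congrArg φ (hp.1 x y z t)
  · simpa [push] using congrArg φ (hp.2.1 x y z)
  · simpa [push] using congrArg φ (hp.2.2 x y z)

theorem mem_cocycles_of_push {M : Type v} [AddCommGroup M] {φ : M →+ D}
    (hφ : Function.Injective φ) {p : (G → G → G → M) × (G → G → M)}
    (hp : push φ p ∈ cocycles G D) : p ∈ cocycles G M := by
  refine ⟨fun x y z t => hφ ?_, fun x y z => hφ ?_, fun x y z => hφ ?_⟩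
  · simpa [push] using hp.1 x y z t
  · simpa [push] using hp.2.1 x y z
  · simpa [push] using hp.2.2 x y z

/-- If the values of `k` become a symmetric 2-cocycle modulo the subgroup `M` of a divisible
group, then `k` may be changed to be `M`-valued without changing its coboundary. -/
theorem exists_eq_cobd_of_push_eq_cobd [DivisibleBy D ℤ] {M : Type v} [AddCommGroup M]
    {φ : M →+ D} (hφ : Function.Injective φ) (p : (G → G → G → M) × (G → G → M))
    (k : G → G → D) (h : push φ p = cobd k) : ∃ l, p = cobd l := by
  let _ : DivisibleBy (D ⧸ φ.range) ℤ :=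
    (QuotientAddGroup.mk'_surjective φ.range).divisibleBy _
      fun a n => map_zsmul (QuotientAddGroup.mk' φ.range) n a
  have h0 : cobd (fun x y => QuotientAddGroup.mk' φ.range (k x y)) = 0 := by
    rw [← push_cobd, ← h]
    ext <;> simp [push]
  obtain ⟨f, hf⟩ := exists_of_cobd_eq_zero _ h0
  choose g hg using fun x => QuotientAddGroup.mk'_surjective φ.range (f x)
  -- Lifting `f` to `g` and subtracting g(x) + g(y) - g(x + y) makes `k` take values in M; that
  -- correction has zero coboundary.
  have hm (x y) : k x y - (g x + g y - g (x + y)) ∈ φ.range := by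
    rw [← QuotientAddGroup.ker_mk' φ.range, AddMonoidHom.mem_ker, map_sub, map_sub, map_add, hf,
      hg, hg, hg, sub_self]
  choose l hl using hm
  refine ⟨l, push_injective hφ ?_⟩
  rw [h, push_cobd]
  ext x y z
  · simp only [cobd, hl, add_assoc]
    abel
  · simp only [cobd, hl, add_comm y x]
    abel

/-- Every abelian group embeds in a divisible one. -/
theorem exists_injective_divisible (M : Type v) [AddCommGroup M] :
    ∃ (D : Type v) (_ : AddCommGroup D) (_ : DivisibleBy D ℤ) (φ : M →+ D),
      Function.Injective φ :=
  ⟨CharacterModule M → AddCircle (1 : ℚ), inferInstance, inferInstance,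
    AddMonoidHom.mk' (fun a χ => χ a) (fun a b => by ext χ; simp),
    (injective_iff_map_eq_zero _).2 fun _ h0 =>
      CharacterModule.eq_zero_of_character_apply (congr_fun h0 ·)⟩

end Divisible

/-! ### Filtered colimits of sets under products, sums and free groups -/

section FilteredUnion

variable {J : Type u} [SmallCategory J]

/-- The set `X` is the colimit of the sets `T i`, expressed through elements, for transition
maps `m` and structure maps `t`. -/
structure IsFilteredUnion (T : J → Type u) (m : ∀ {i j : J}, (i ⟶ j) → T i → T j) (X : Type u)
    (t : ∀ i, T i → X) : Prop where
  map_comp : ∀ {i j k : J} (a : i ⟶ j) (b : j ⟶ k) (x : T i), m (a ≫ b) x = m b (m a x)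
  t_map : ∀ {i j : J} (a : i ⟶ j) (x : T i), t j (m a x) = t i x
  exists_rep : ∀ x, ∃ i y, t i y = x
  exists_eq : ∀ {i : J} (x y : T i), t i x = t i y → ∃ (j : J) (a : i ⟶ j), m a x = m a y

namespace IsFilteredUnion

variable {T : J → Type u} {m : ∀ {i j : J}, (i ⟶ j) → T i → T j} {X : Type u} {t : ∀ i, T i → X}
  {T' : J → Type u} {m' : ∀ {i j : J}, (i ⟶ j) → T' i → T' j} {X' : Type u} {t' : ∀ i, T' i → X'}

theorem prod [IsFiltered J] (h : IsFilteredUnion T m X t) (h' : IsFilteredUnion T' m' X' t') :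
    IsFilteredUnion (fun i => T i × T' i) (fun a => Prod.map (m a) (m' a)) (X × X')
      (fun i => Prod.map (t i) (t' i)) where
  map_comp a b x := Prod.ext (h.map_comp a b x.1) (h'.map_comp a b x.2)
  t_map a x := Prod.ext (h.t_map a x.1) (h'.t_map a x.2)
  exists_rep := by
    rintro ⟨x, x'⟩
    obtain ⟨i, y, rfl⟩ := h.exists_rep x
    obtain ⟨j, y', rfl⟩ := h'.exists_rep x'
    exact ⟨IsFiltered.max i j, (m (IsFiltered.leftToMax i j) y, m' (IsFiltered.rightToMax i j) y'),
      Prod.ext (h.t_map _ _) (h'.t_map _ _)⟩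
  exists_eq := by
    rintro i ⟨x, x'⟩ ⟨y, y'⟩ hxy
    obtain ⟨j, a, ha⟩ := h.exists_eq x y (congrArg Prod.fst hxy)
    obtain ⟨k, b, hb⟩ := h'.exists_eq (m' a x') (m' a y')
      (by rw [h'.t_map, h'.t_map]; exact congrArg Prod.snd hxy)
    refine ⟨k, a ≫ b, Prod.ext ?_ ?_⟩
    · change m (a ≫ b) x = m (a ≫ b) y
      rw [h.map_comp, h.map_comp, ha]
    · change m' (a ≫ b) x' = m' (a ≫ b) y'
      rw [h'.map_comp, h'.map_comp, hb]

theorem sum (h : IsFilteredUnion T m X t) (h' : IsFilteredUnion T' m' X' t') :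
    IsFilteredUnion (fun i => T i ⊕ T' i) (fun a => Sum.map (m a) (m' a)) (X ⊕ X')
      (fun i => Sum.map (t i) (t' i)) where
  map_comp a b x := by
    rcases x with x | x
    · exact congrArg Sum.inl (h.map_comp a b x)
    · exact congrArg Sum.inr (h'.map_comp a b x)
  t_map a x := by
    rcases x with x | x
    · exact congrArg Sum.inl (h.t_map a x)
    · exact congrArg Sum.inr (h'.t_map a x)
  exists_rep := by
    rintro (x | x)
    · obtain ⟨i, y, rfl⟩ := h.exists_rep x
      exact ⟨i, Sum.inl y, rfl⟩
    · obtain ⟨i, y, rfl⟩ := h'.exists_rep x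
      exact ⟨i, Sum.inr y, rfl⟩
  exists_eq := by
    rintro i (x | x) (y | y) hxy
    · obtain ⟨j, a, ha⟩ := h.exists_eq x y (Sum.inl_injective hxy)
      exact ⟨j, a, congrArg Sum.inl ha⟩
    · cases hxy
    · cases hxy
    · obtain ⟨j, a, ha⟩ := h'.exists_eq x y (Sum.inr_injective hxy)
      exact ⟨j, a, congrArg Sum.inr ha⟩

/-- Finitely many identifications made in the colimit all hold at one later stage. -/
theorem exists_forall_mem_eq (h : IsFilteredUnion T m X t) {i : J} (s : Finset (T i × T i)) :
    ∃ (j : J) (a : i ⟶ j), ∀ p ∈ s, t i p.1 = t i p.2 → m a p.1 = m a p.2 := by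
  classical
  induction s using Finset.induction_on with
  | empty => exact ⟨i, 𝟙 i, by simp⟩
  | insert q s _ ih =>
    obtain ⟨j, a, ha⟩ := ih
    by_cases hq : t i q.1 = t i q.2
    · obtain ⟨k, b, hb⟩ := h.exists_eq (m a q.1) (m a q.2) (by rw [h.t_map, h.t_map, hq])
      refine ⟨k, a ≫ b, fun p hp hpt => ?_⟩
      rw [h.map_comp, h.map_comp]
      rcases Finset.mem_insert.1 hp with rfl | hp
      · exact hb
      · rw [ha p hp hpt]
    · refine ⟨j, a, fun p hp hpt => ?_⟩
      rcases Finset.mem_insert.1 hp with rfl | hp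
      · exact absurd hpt hq
      · exact ha p hp hpt

theorem finsupp [IsFiltered J] (h : IsFilteredUnion T m X t) :
    IsFilteredUnion (fun i => T i →₀ ℤ) (fun a => Finsupp.mapDomain (m a)) (X →₀ ℤ)
      (fun i => Finsupp.mapDomain (t i)) where
  map_comp a b x := by
    rw [← Finsupp.mapDomain_comp]
    exact Finsupp.mapDomain_congr fun y _ => h.map_comp a b y
  t_map a x := by
    rw [← Finsupp.mapDomain_comp]
    exact Finsupp.mapDomain_congr fun y _ => h.t_map a y
  exists_rep z := by
    induction z using Finsupp.induction_linear with
    | zero => exact ⟨IsFiltered.nonempty.some, 0, Finsupp.mapDomain_zero⟩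
    | single x n =>
      obtain ⟨i, y, rfl⟩ := h.exists_rep x
      exact ⟨i, Finsupp.single y n, Finsupp.mapDomain_single⟩
    | add z w hz hw =>
      obtain ⟨i, z, rfl⟩ := hz
      obtain ⟨j, w, rfl⟩ := hw
      refine ⟨IsFiltered.max i j, Finsupp.mapDomain (m (IsFiltered.leftToMax i j)) z +
        Finsupp.mapDomain (m (IsFiltered.rightToMax i j)) w, ?_⟩
      rw [Finsupp.mapDomain_add, ← Finsupp.mapDomain_comp, ← Finsupp.mapDomain_comp]
      congr 1
      · exact Finsupp.mapDomain_congr fun y _ => h.t_map _ y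
      · exact Finsupp.mapDomain_congr fun y _ => h.t_map _ y
  exists_eq {i} z w hzw := by
    classical
    let s := z.support ∪ w.support
    obtain ⟨j, a, ha⟩ := h.exists_forall_mem_eq (s ×ˢ s)
    refine ⟨j, a, ?_⟩
    -- At stage `j` all identifications among support points have been made, so `t j` is injective
    -- on their images and `mapDomain` loses nothing there.
    have hinj : Set.InjOn (t j) (s.image (m a) : Finset (T j)) := by
      intro x hx y hy hxy
      obtain ⟨x, hxs, rfl⟩ := Finset.mem_image.1 hx
      obtain ⟨y, hys, rfl⟩ := Finset.mem_image.1 hy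
      rw [h.t_map, h.t_map] at hxy
      exact ha (x, y) (Finset.mk_mem_product hxs hys) hxy
    have hsupp (v : T i →₀ ℤ) (hv : v.support ⊆ s) :
        ((Finsupp.mapDomain (m a) v).support : Set (T j)) ⊆ (s.image (m a) : Finset (T j)) :=
      Finset.coe_subset.2 (Finsupp.mapDomain_support.trans (Finset.image_subset_image hv))
    have hmap (v : T i →₀ ℤ) :
        Finsupp.mapDomain (t j) (Finsupp.mapDomain (m a) v) = Finsupp.mapDomain (t i) v := by
      rw [← Finsupp.mapDomain_comp]
      exact Finsupp.mapDomain_congr fun y _ => h.t_map a y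
    exact Finsupp.mapDomain_injOn _ hinj (hsupp z Finset.subset_union_left)
      (hsupp w Finset.subset_union_right) (by rw [hmap, hmap, hzw])

end IsFilteredUnion

end FilteredUnion

/-! ### Cohomology classes on a filtered colimit of groups -/

section Colimit

variable {J : Type u} [SmallCategory J] [IsFiltered J] {F : J ⥤ AddCommGrpCat.{u}} {c : Cocone F}

theorem isFilteredUnion_of_isColimit (hc : IsColimit c) :
    IsFilteredUnion (fun i => F.obj i) (fun a => (F.map a).hom) c.pt
      (fun i => (c.ι.app i).hom) where
  map_comp a b x := by simp
  t_map a x := by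
    rw [← c.w a]
    rfl
  exists_rep x := Concrete.isColimit_exists_rep F hc x
  exists_eq {i} x y hxy := by
    obtain ⟨j, a, b, hab⟩ := Concrete.isColimit_exists_of_rep_eq.{u} F hc x y hxy
    -- The two elements become equal along possibly different arrows `a` and `b`; coequalising them
    -- gives a single arrow.
    refine ⟨IsFiltered.coeq a b, a ≫ IsFiltered.coeqHom a b, ?_⟩
    have hab' : (F.map a).hom x = (F.map b).hom y := hab
    conv_rhs => rw [IsFiltered.coeq_condition a b]
    simp [hab']

theorem isFilteredUnion_chains (hc : IsColimit c) :
    IsFilteredUnion (fun i => Cell (F.obj i) →₀ ℤ) (fun a => chainMap (F.map a).hom)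
      (Cell c.pt →₀ ℤ) (fun i => chainMap (c.ι.app i).hom) :=
  have h := isFilteredUnion_of_isColimit hc
  ((h.prod (h.prod h)).sum (h.prod h)).finsupp

theorem isFilteredUnion_pairs (hc : IsColimit c) :
    IsFilteredUnion (fun i => F.obj i × F.obj i →₀ ℤ) (fun a => pairMap (F.map a).hom)
      (c.pt × c.pt →₀ ℤ) (fun i => pairMap (c.ι.app i).hom) :=
  have h := isFilteredUnion_of_isColimit hc
  (h.prod h).finsupp

/-- Every cycle of a filtered colimit comes from a cycle at a finite stage. -/
theorem exists_cycle_lift (hc : IsColimit c) {z : Cell c.pt →₀ ℤ} (hz : chainD c.pt z = 0) :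
    ∃ (i : J) (w : Cell (F.obj i) →₀ ℤ), chainD _ w = 0 ∧ chainMap (c.ι.app i).hom w = z := by
  obtain ⟨i, w, hw⟩ := (isFilteredUnion_chains hc).exists_rep z
  -- The boundary of `w` vanishes in the colimit, hence already at a later stage.
  obtain ⟨j, a, ha⟩ := (isFilteredUnion_pairs hc).exists_eq (chainD _ w) 0 (by
    rw [map_zero, ← chainD_chainMap, hw]
    exact hz)
  refine ⟨j, chainMap (F.map a).hom w, ?_, ?_⟩
  · rw [chainD_chainMap, ha, map_zero]
  · rw [(isFilteredUnion_chains hc).t_map, hw]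

/-- A cochain on a filtered colimit with divisible values is a coboundary if it is one at
every finite stage. -/
theorem exists_eq_cobd_of_forall_divisible {D : Type v} [AddCommGroup D] [DivisibleBy D ℤ]
    (hc : IsColimit c) (p : (c.pt → c.pt → c.pt → D) × (c.pt → c.pt → D))
    (hp : ∀ i, ∃ k, pullback (c.ι.app i).hom p = cobd k) : ∃ k, p = cobd k := by
  refine exists_eq_cobd_of_eval_eq_zero p fun z hz => ?_
  obtain ⟨i, w, hw, rfl⟩ := exists_cycle_lift hc hz
  obtain ⟨k, hk⟩ := hp i
  rw [eval_chainMap, hk, eval_cobd_of_chainD_eq_zero k hw]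

theorem push_pullback {M D : Type v} [AddCommGroup M] [AddCommGroup D] (φ : M →+ D)
    {G G' : Type u} [AddCommGroup G] [AddCommGroup G'] (f : G →+ G')
    (p : (G' → G' → G' → M) × (G' → G' → M)) :
    pullback f (push φ p) = push φ (pullback f p) := rfl

theorem pullback_sub {M : Type v} [AddCommGroup M]
    {G G' : Type u} [AddCommGroup G] [AddCommGroup G'] (f : G →+ G')
    (p q : (G' → G' → G' → M) × (G' → G' → M)) :
    pullback f (p - q) = pullback f p - pullback f q := rfl

theorem pullback_cobd {M : Type v} [AddCommGroup M]
    {G G' : Type u} [AddCommGroup G] [AddCommGroup G'] (f : G →+ G') (k : G' → G' → M) :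
    pullback f (cobd k) = cobd (fun x y => k (f x) (f y)) := by
  simp [pullback, cobd]

/-- A cochain on a filtered colimit is a coboundary if it is one at every finite stage. -/
theorem exists_eq_cobd_of_forall {M : Type v} [AddCommGroup M]
    (hc : IsColimit c) (p : (c.pt → c.pt → c.pt → M) × (c.pt → c.pt → M))
    (hp : ∀ i, ∃ k, pullback (c.ι.app i).hom p = cobd k) : ∃ k, p = cobd k := by
  obtain ⟨D, _, _, φ, hφ⟩ := exists_injective_divisible M
  obtain ⟨k, hk⟩ := exists_eq_cobd_of_forall_divisible hc (push φ p) fun i => by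
    obtain ⟨k, hk⟩ := hp i
    exact ⟨_, by rw [push_pullback, hk, push_cobd]⟩
  exact exists_eq_cobd_of_push_eq_cobd hφ p k hk

/-- Compatible classes on a filtered diagram have well defined values on cycles. -/
theorem eval_eq_of_chainMap_eq {D : Type v} [AddCommGroup D] (hc : IsColimit c)
    (p : ∀ i, (F.obj i → F.obj i → F.obj i → D) × (F.obj i → F.obj i → D))
    (hp : ∀ {i j : J} (a : i ⟶ j), ∃ k, pullback (F.map a).hom (p j) - p i = cobd k)
    {i j : J} {z : Cell (F.obj i) →₀ ℤ} {w : Cell (F.obj j) →₀ ℤ} (hz : chainD _ z = 0)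
    (hw : chainD _ w = 0) (h : chainMap (c.ι.app i).hom z = chainMap (c.ι.app j).hom w) :
    eval (p i) z = eval (p j) w := by
  have hU := isFilteredUnion_chains hc
  have key {i j : J} (a : i ⟶ j) {z : Cell (F.obj i) →₀ ℤ} (hz : chainD _ z = 0) :
      eval (p j) (chainMap (F.map a).hom z) = eval (p i) z := by
    obtain ⟨k, hk⟩ := hp a
    rw [eval_chainMap, ← sub_eq_zero, ← LinearMap.sub_apply, ← eval_sub, hk,
      eval_cobd_of_chainD_eq_zero k hz]
  have hcyc {i j : J} (a : i ⟶ j) {z : Cell (F.obj i) →₀ ℤ} (hz : chainD _ z = 0) :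
      chainD _ (chainMap (F.map a).hom z) = 0 := by
    rw [chainD_chainMap, hz, map_zero]
  obtain ⟨l, b, hb⟩ := hU.exists_eq (chainMap (F.map (IsFiltered.leftToMax i j)).hom z)
    (chainMap (F.map (IsFiltered.rightToMax i j)).hom w) (by rw [hU.t_map, hU.t_map, h])
  rw [← key (IsFiltered.leftToMax i j) hz, ← key (IsFiltered.rightToMax i j) hw,
    ← key b (hcyc _ hz), ← key b (hcyc _ hw), hb]

/-- Compatible classes on a filtered diagram with divisible values come from the colimit. -/
theorem exists_cocycle_of_forall_divisible {D : Type v} [AddCommGroup D] [DivisibleBy D ℤ]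
    (hc : IsColimit c)
    (p : ∀ i, (F.obj i → F.obj i → F.obj i → D) × (F.obj i → F.obj i → D))
    (hcoc : ∀ i, p i ∈ cocycles (F.obj i) D)
    (hp : ∀ {i j : J} (a : i ⟶ j), ∃ k, pullback (F.map a).hom (p j) - p i = cobd k) :
    ∃ q ∈ cocycles c.pt D, ∀ i, ∃ k, pullback (c.ι.app i).hom q - p i = cobd k := by
  have hU := isFilteredUnion_chains hc
  -- The lifts are arbitrary; `eval_eq_of_chainMap_eq` makes the value independent of them, which
  -- also yields additivity at a common stage.
  choose s w hw hwz using fun z : LinearMap.ker (chainD c.pt) => exists_cycle_lift hc z.2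
  have hcyc {i j : J} (a : i ⟶ j) {z : Cell (F.obj i) →₀ ℤ} (hz : chainD _ z = 0) :
      chainD _ (chainMap (F.map a).hom z) = 0 := by
    rw [chainD_chainMap, hz, map_zero]
  let φ : LinearMap.ker (chainD c.pt) →+ D :=
    AddMonoidHom.mk' (fun z => eval (p (s z)) (w z)) fun x y => by
      let a := IsFiltered.leftToMax (s x) (s y)
      let b := IsFiltered.rightToMax (s x) (s y)
      have hx := hcyc a (hw x)
      have hy := hcyc b (hw y)
      rw [eval_eq_of_chainMap_eq hc p hp (hw x) hx (hU.t_map a _).symm,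
        eval_eq_of_chainMap_eq hc p hp (hw y) hy (hU.t_map b _).symm, ← map_add]
      refine eval_eq_of_chainMap_eq hc p hp (hw _) (by rw [map_add, hx, hy, add_zero]) ?_
      rw [hwz, map_add, hU.t_map, hU.t_map, hwz, hwz]
      rfl
  -- The choice of extension off the cycles is harmless: the cocycle conditions and the comparison
  -- with each `p i` are tested on cycles only.
  obtain ⟨ψ, hψ⟩ := (Module.Baer.of_divisible D).extension_property
    (LinearMap.ker (chainD c.pt)).subtype Subtype.val_injective φ.toIntLinearMap
  obtain ⟨q, rfl⟩ := exists_eval_eq ψ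
  have key {i : J} {z : Cell (F.obj i) →₀ ℤ} (hz : chainD _ z = 0) :
      eval q (chainMap (c.ι.app i).hom z) = eval (p i) z := by
    have hz' : chainD _ (chainMap (c.ι.app i).hom z) = 0 := by
      rw [chainD_chainMap, hz, map_zero]
    refine (LinearMap.congr_fun hψ ⟨_, hz'⟩).trans ?_
    exact eval_eq_of_chainMap_eq hc p hp (hw _) hz (hwz _)
  have hF := isFilteredUnion_of_isColimit hc
  refine ⟨q, (mem_cocycles_iff q).2 ⟨fun x y z t => ?_, fun x y z => ?_, fun x y z => ?_⟩,
    fun i => exists_eq_cobd_of_eval_eq_zero _ fun z hz => ?_⟩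
  · obtain ⟨i, ⟨x, y, z, t⟩, h⟩ := (hF.prod (hF.prod (hF.prod hF))).exists_rep (x, y, z, t)
    obtain ⟨rfl, rfl, rfl, rfl⟩ : _ ∧ _ ∧ _ ∧ _ := by simpa using h
    rw [← chainMap_pentagonChain, key (chainD_pentagonChain _ _ _ _)]
    exact ((mem_cocycles_iff _).1 (hcoc i)).1 _ _ _ _
  · obtain ⟨i, ⟨x, y, z⟩, h⟩ := (hF.prod (hF.prod hF)).exists_rep (x, y, z)
    obtain ⟨rfl, rfl, rfl⟩ : _ ∧ _ ∧ _ := by simpa using h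
    rw [← chainMap_hexagonChain, key (chainD_hexagonChain _ _ _)]
    exact ((mem_cocycles_iff _).1 (hcoc i)).2.1 _ _ _
  · obtain ⟨i, ⟨x, y, z⟩, h⟩ := (hF.prod (hF.prod hF)).exists_rep (x, y, z)
    obtain ⟨rfl, rfl, rfl⟩ : _ ∧ _ ∧ _ := by simpa using h
    rw [← chainMap_hexagonChain', key (chainD_hexagonChain' _ _ _)]
    exact ((mem_cocycles_iff _).1 (hcoc i)).2.2 _ _ _
  · rw [eval_sub, LinearMap.sub_apply, ← eval_chainMap, key hz, sub_self]

/-- Compatible classes on a filtered diagram come from the colimit. -/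
theorem exists_cocycle_of_forall {M : Type v} [AddCommGroup M] (hc : IsColimit c)
    (p : ∀ i, (F.obj i → F.obj i → F.obj i → M) × (F.obj i → F.obj i → M))
    (hcoc : ∀ i, p i ∈ cocycles (F.obj i) M)
    (hp : ∀ {i j : J} (a : i ⟶ j), ∃ k, pullback (F.map a).hom (p j) - p i = cobd k) :
    ∃ q ∈ cocycles c.pt M, ∀ i, ∃ k, pullback (c.ι.app i).hom q - p i = cobd k := by
  obtain ⟨D, _, _, φ, hφ⟩ := exists_injective_divisible M
  obtain ⟨q, hq, hqp⟩ := exists_cocycle_of_forall_divisible hc (fun i => push φ (p i))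
    (fun i => push_mem_cocycles φ (hcoc i)) (fun a => by
      obtain ⟨k, hk⟩ := hp a
      exact ⟨_, by rw [push_pullback, ← push_sub, hk, push_cobd]⟩)
  let π := QuotientAddGroup.mk' φ.range
  have hπφ (a : M) : π (φ a) = 0 := by simp [π]
  -- Modulo M each `p i` vanishes, so `q` becomes a coboundary at every stage, hence on the colimit.
  -- Correcting `q` by a lift `l'` of the primitive makes it M-valued.
  obtain ⟨l, hl⟩ := exists_eq_cobd_of_forall hc (push π q) fun i => by
    obtain ⟨k, hk⟩ := hqp i
    refine ⟨fun x y => π (k x y), ?_⟩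
    rw [← push_cobd, ← hk, push_sub, push_pullback]
    ext <;> simp [push, hπφ]
  choose l' hl' using fun x y => QuotientAddGroup.mk'_surjective φ.range (l x y)
  have hzero : push π (q - cobd l') = 0 := by
    rw [push_sub, push_cobd, hl, sub_eq_zero]
    exact congrArg cobd (funext₂ hl').symm
  have hker {d : D} (hd : π d = 0) : ∃ a, φ a = d := by
    rwa [← AddMonoidHom.mem_ker, QuotientAddGroup.ker_mk'] at hd
  choose r₁ hr₁ using fun x y z =>
    hker (congrFun (congrFun (congrFun (congrArg Prod.fst hzero) x) y) z)
  choose r₂ hr₂ using fun x y => hker (congrFun (congrFun (congrArg Prod.snd hzero) x) y)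
  have hr : push φ (r₁, r₂) = q - cobd l' :=
    Prod.ext (funext fun x => funext₂ (hr₁ x)) (funext₂ hr₂)
  refine ⟨(r₁, r₂), mem_cocycles_of_push hφ ?_, fun i => ?_⟩
  · rw [hr]
    exact sub_mem hq (coboundary c.pt D l').2
  · obtain ⟨k, hk⟩ := hqp i
    -- The comparison with `p i` is known over D; injectivity of H³(-, M) → H³(-, D) brings it back
    -- to M.
    refine exists_eq_cobd_of_push_eq_cobd hφ _
      (k - fun x y => l' ((c.ι.app i).hom x) ((c.ι.app i).hom y)) ?_
    rw [push_sub, ← push_pullback, hr, pullback_sub, pullback_cobd, cobd_sub, ← hk]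
    abel

end Colimit

/-! ### From cochains to classes, and the limit property -/

theorem H3_mk_eq_mk_iff {G : Type u} [AddCommGroup G] {M : Type v} [AddCommGroup M]
    (p q : cocycles G M) :
    (QuotientAddGroup.mk p : H3 G M) = QuotientAddGroup.mk q ↔
      ∃ k, (q - p : (G → G → G → M) × (G → G → M)) = cobd k := by
  rw [QuotientAddGroup.eq, neg_add_eq_sub]
  constructor
  · rintro ⟨k, hk⟩
    exact ⟨k, (congrArg Subtype.val hk).symm⟩
  · rintro ⟨k, hk⟩
    exact ⟨k, Subtype.ext hk.symm⟩

end TwoAb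

theorem mainTheorem6 (M : Type v) [AddCommGroup M]
    {J : Type u} [SmallCategory J] [IsFiltered J] (F : J ⥤ AddCommGrpCat.{u})
    (c : Cocone F) (hc : IsColimit c) :
    Nonempty (IsLimit ((TwoAb.H3Functor.{u, v} M).mapCone c.op)) := by
  -- The forgetful functor reflects limits, so it suffices that each compatible family of classes
  -- has a unique preimage.
  suffices h : Nonempty (IsLimit
      ((forget AddCommGrpCat.{max u v}).mapCone ((TwoAb.H3Functor.{u, v} M).mapCone c.op))) from
    ⟨isLimitOfReflects (forget AddCommGrpCat.{max u v}) h.some⟩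
  rw [Types.isLimit_iff]
  intro s hs
  choose p hp using fun i : J => show ∃ p : TwoAb.cocycles (F.obj i) M,
    (QuotientAddGroup.mk p : TwoAb.H3 (F.obj i) M) = s (op i) from
      QuotientAddGroup.mk_surjective _
  have hcomp {i j : J} (a : i ⟶ j) :
      ∃ k, TwoAb.pullback (F.map a).hom (p j).1 - (p i).1 = TwoAb.cobd k := by
    refine (TwoAb.H3_mk_eq_mk_iff (p i) (TwoAb.cocyclesMap M (F.map a).hom (p j))).1 ?_
    rw [hp i]
    refine (hs a.op).symm.trans ?_
    change TwoAb.H3Map M (F.map a).hom (s (op j)) = _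
    rw [← hp j]
    rfl
  obtain ⟨q, hq, hqp⟩ := TwoAb.exists_cocycle_of_forall hc (fun i => (p i).1)
    (fun i => (p i).2) hcomp
  refine ⟨(QuotientAddGroup.mk ⟨q, hq⟩ : TwoAb.H3 c.pt M), fun i => ?_, fun y hy => ?_⟩
  · rw [← hp i.unop]
    exact ((TwoAb.H3_mk_eq_mk_iff (p i.unop)
      (TwoAb.cocyclesMap M (c.ι.app i.unop).hom ⟨q, hq⟩)).2 (hqp i.unop)).symm
  · obtain ⟨r, rfl⟩ := QuotientAddGroup.mk_surjective (y : TwoAb.H3 c.pt M)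
    refine (TwoAb.H3_mk_eq_mk_iff r ⟨q, hq⟩).2 ?_
    refine TwoAb.exists_eq_cobd_of_forall hc _ fun i => ?_
    refine (TwoAb.H3_mk_eq_mk_iff (TwoAb.cocyclesMap M (c.ι.app i).hom r)
      (TwoAb.cocyclesMap M (c.ι.app i).hom ⟨q, hq⟩)).1 ?_
    refine (hy (op i)).trans ?_
    rw [← hp i]
    exact (TwoAb.H3_mk_eq_mk_iff (p i)
      (TwoAb.cocyclesMap M (c.ι.app i).hom ⟨q, hq⟩)).2 (hqp i)
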